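/- Let $\mathrm{REF}(\mathrm{inf})$ be the first-order theory in the language $\{E_n : n\in\omega\}$ of countably many binary relation symbols which asserts that each $E_n$ is an equivalence relation, that $E_0$ has a single class, that each $E_{n+1}$ refines $E_n$, and that each $E_n$-class is partitioned into infinitely many $E_{n+1}$-classes. It is regarded as a sentence of $L_{\omega_1,\omega}$, the conjunction of its axioms. For a sentence $\Phi$ of $L_{\omega_1,\omega}$ in a countable language and an infinite cardinal $\lambda$, let $\mathrm{Mod}_\lambda(\Phi)$ be the set of models of $\Phi$ with universe $\lambda$, and put $\mathrm{Mod}(\Phi)=\mathrm{Mod}_{\omega}(\Phi)$. The sets $U_{\theta(\bar\alpha)}=\{M : M\models\theta(\bar\alpha)\}$, with $\theta$ a quantifier-free first-order formula and $\bar\alpha$ a finite tuple from $\lambda$, form the sub-basis of the topology of $\mathrm{Mod}_\lambda(\Phi)$; a subset of $\mathrm{Mod}_\lambda(\Phi)$ is $\lambda$-Borel if it belongs to the least family that contains the sub-basis and is closed under complements and under unions of at most $\lambda$ members. Two structures are $\equiv_{\infty,\omega}$-equivalent if they satisfy the same sentences of $L_{\infty,\omega}$. The sentence $\Phi$ is Borel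 complete if for every sentence $\Psi$ of $L'_{\omega_1,\omega}$ in a countable language $L'$ there is a Borel map $f:\mathrm{Mod}(\Psi)\to\mathrm{Mod}(\Phi)$ such that, for all $M,N\in\mathrm{Mod}(\Psi)$, $M\cong N$ if and only if $f(M)\cong f(N)$. The sentence $\Phi$ is $\lambda$-Borel complete if for every sentence $\Psi$ of $L'_{\omega_1,\omega}$ in a countable language $L'$ there is a map $f:\mathrm{Mod}_\lambda(\Psi)\to\mathrm{Mod}_\lambda(\Phi)$ such that the inverse image of every sub-basic open set is $\lambda$-Borel and, for all $M,N\in\mathrm{Mod}_\lambda(\Psi)$, $M\equiv_{\infty,\omega}N$ if and only if $f(M)\equiv_{\infty,\omega}f(N)$. Theorem. $\mathrm{REF}(\mathrm{inf})$ is Borel complete. Indeed, for each infinite cardinal $\lambda$, $\mathrm{REF}(\mathrm{inf})$ is $\lambda$-Borel complete. -/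

import Mathlib

open Cardinal FirstOrder

universe u v w x

namespace BorelComplexity

/-! ### Infinitary logic -/

/-- Formulas of the infinitary logic `L_{κ,ω}` whose free variables are among `x_0, …, x_{n-1}`:
conjunctions of fewer than `κ` formulas, and quantification over one variable at a time.
Negation, disjunctions and existential quantifiers are expressed as usual through
`falsum`, `imp`, `conj` and `all`. -/
inductive InfFormula (L : FirstOrder.Language.{u, v}) (κ : Cardinal.{w}) : ℕ → Type (max u v (w + 1))
  | falsum {n : ℕ} : InfFormula L κ n
  | equal {n : ℕ} (s t : L.Term (Fin n)) : InfFormula L κ n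
  | rel {n l : ℕ} (R : L.Relations l) (ts : Fin l → L.Term (Fin n)) : InfFormula L κ n
  | imp {n : ℕ} (φ ψ : InfFormula L κ n) : InfFormula L κ n
  | conj {n : ℕ} (ι : Type w) (hι : #ι < κ) (φ : ι → InfFormula L κ n) : InfFormula L κ n
  | all {n : ℕ} (φ : InfFormula L κ (n + 1)) : InfFormula L κ n

/-- Sentences of `L_{κ,ω}`. -/
abbrev InfSentence (L : FirstOrder.Language.{u, v}) (κ : Cardinal.{w}) : Type (max u v (w + 1)) :=
  InfFormula L κ 0

/-- Satisfaction of a formula of `L_{κ,ω}`; the bound variable of `all φ` is the last one. -/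
def InfFormula.Realize {L : FirstOrder.Language.{u, v}} {κ : Cardinal.{w}} {X : Type x} [L.Structure X] :
    {n : ℕ} → InfFormula L κ n → (Fin n → X) → Prop
  | _, .falsum, _ => False
  | _, .equal s t, a => s.realize a = t.realize a
  | _, .rel R ts, a => Language.Structure.RelMap R fun i => (ts i).realize a
  | _, .imp φ ψ, a => φ.Realize a → ψ.Realize a
  | _, .conj _ _ φ, a => ∀ i, (φ i).Realize a
  | _, .all φ, a => ∀ b : X, φ.Realize (Fin.snoc a b)

/-- `X ⊨ Φ` for a sentence `Φ` of `L_{κ,ω}`. -/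
def InfSentence.Holds {L : FirstOrder.Language.{u, v}} {κ : Cardinal.{w}} (Φ : InfSentence L κ)
    (X : Type x) [L.Structure X] : Prop :=
  InfFormula.Realize Φ (Fin.elim0 : Fin 0 → X)

/-- Every first-order formula is a formula of `L_{κ,ω}`. -/
def InfFormula.ofFirstOrder {L : FirstOrder.Language.{u, v}} {κ : Cardinal.{w}} :
    {n : ℕ} → L.BoundedFormula Empty n → InfFormula L κ n
  | _, .falsum => .falsum
  | _, .equal s t =>
      .equal (s.relabel (Sum.elim Empty.elim id)) (t.relabel (Sum.elim Empty.elim id))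
  | _, .rel R ts => .rel R fun i => (ts i).relabel (Sum.elim Empty.elim id)
  | _, .imp φ ψ => .imp (ofFirstOrder φ) (ofFirstOrder ψ)
  | _, .all φ => .all (ofFirstOrder φ)

theorem InfFormula.realize_ofFirstOrder {L : FirstOrder.Language.{u, v}} {κ : Cardinal.{w}} {X : Type x}
    [L.Structure X] {n : ℕ} (φ : L.BoundedFormula Empty n) (a : Fin n → X) :
    (ofFirstOrder φ : InfFormula L κ n).Realize a ↔ φ.Realize default a := by
  have key : ∀ {m : ℕ} (b : Fin m → X),
      b ∘ (Sum.elim Empty.elim id : Empty ⊕ Fin m → Fin m) = Sum.elim default b := by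
    intro m b
    funext i
    rcases i with i | i
    · exact i.elim
    · rfl
  induction φ with
  | falsum => rfl
  | equal s t =>
    simp [ofFirstOrder, Realize, Language.BoundedFormula.Realize, Language.Term.realize_relabel,
      key]
  | rel R ts =>
    simp [ofFirstOrder, Realize, Language.BoundedFormula.Realize, Language.Term.realize_relabel,
      key]
  | imp φ ψ ih1 ih2 =>
    simp [ofFirstOrder, Realize, Language.BoundedFormula.Realize, ih1, ih2]
  | all φ ih =>
    simp [ofFirstOrder, Realize, Language.BoundedFormula.Realize, ih]

/-- The sentence of `L_{ω₁,ω}` that axiomatizes a countable first-order theory: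
the conjunction of its axioms. -/
noncomputable def InfSentence.ofTheory {L : FirstOrder.Language.{0, 0}} (T : L.Theory) (hT : T.Countable) :
    InfSentence L (ℵ₁ : Cardinal.{0}) :=
  .conj T (Cardinal.succ_aleph0 ▸ Order.lt_succ_of_le (Cardinal.le_aleph0_iff_set_countable.2 hT))
    fun φ => .ofFirstOrder φ.1

theorem InfSentence.holds_ofTheory {L : FirstOrder.Language.{0, 0}} (T : L.Theory) (hT : T.Countable)
    (X : Type x) [L.Structure X] : (InfSentence.ofTheory T hT).Holds X ↔ X ⊨ T := by
  rw [Language.Theory.model_iff]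
  simp only [InfSentence.Holds, InfSentence.ofTheory, InfFormula.Realize, Subtype.forall]
  refine forall₂_congr fun φ _ => ?_
  rw [InfFormula.realize_ofFirstOrder, Language.Sentence.Realize, Language.Formula.Realize,
    Subsingleton.elim (Fin.elim0 : Fin 0 → X) default]

/-- `M ≡_{∞,ω} N`: the structures satisfy the same sentences of `L_{∞,ω} = ⋃_κ L_{κ,ω}`. -/
def InfEquiv (L : FirstOrder.Language.{0, 0}) (M N : Type u) [L.Structure M] [L.Structure N] : Prop :=
  ∀ (κ : Cardinal.{u}) (φ : InfSentence L κ), φ.Holds M ↔ φ.Holds N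

/-! ### Spaces of models -/

/-- The models of the sentence `Φ` of `L_{ω₁,ω}` whose universe is `X`. -/
def Mod {L : FirstOrder.Language.{0, 0}} (Φ : InfSentence L (ℵ₁ : Cardinal.{0})) (X : Type u) : Type u :=
  {S : L.Structure X // @InfSentence.Holds _ _ Φ X S}

namespace Mod

variable {L : FirstOrder.Language.{0, 0}} {Φ : InfSentence L (ℵ₁ : Cardinal.{0})} {X : Type u}

/-- The set `U_{θ(ā)}` of the models that satisfy `θ(ā)`. -/
def basicSet (Φ : InfSentence L (ℵ₁ : Cardinal.{0})) {n : ℕ} (θ : L.Formula (Fin n))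
    (a : Fin n → X) : Set (Mod Φ X) :=
  {M | @Language.Formula.Realize L X M.1 (Fin n) θ a}

/-- The sub-basis: all the `U_{θ(ā)}` with `θ` quantifier-free and `ā` a finite tuple from `X`. -/
def subbasis (Φ : InfSentence L (ℵ₁ : Cardinal.{0})) (X : Type u) : Set (Set (Mod Φ X)) :=
  {U | ∃ (n : ℕ) (θ : L.Formula (Fin n)) (a : Fin n → X), θ.IsQF ∧ U = basicSet Φ θ a}

/-- The logic topology. -/
instance : TopologicalSpace (Mod Φ X) := TopologicalSpace.generateFrom (subbasis Φ X)

/-- Isomorphism of two models with universe `X`. -/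
def Iso (M N : Mod Φ X) : Prop :=
  Nonempty (@Language.Equiv L X X M.1 N.1)

/-- `≡_{∞,ω}` for two models with universe `X`. -/
def Equivalent (M N : Mod Φ X) : Prop :=
  @InfEquiv L X X M.1 N.1

end Mod

/-! ### Borel completeness -/

/-- `(Mod(Ψ), ≅)` is Borel reducible to `(Mod(Φ), ≅)`; the universe of the models is `ℕ`. -/
def BorelReducible {L' L : FirstOrder.Language.{0, 0}} (Ψ : InfSentence L' (ℵ₁ : Cardinal.{0}))
    (Φ : InfSentence L (ℵ₁ : Cardinal.{0})) : Prop :=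
  ∃ f : Mod Ψ ℕ → Mod Φ ℕ,
    @Measurable _ _ (borel (Mod Ψ ℕ)) (borel (Mod Φ ℕ)) f ∧
      ∀ M N : Mod Ψ ℕ, M.Iso N ↔ (f M).Iso (f N)

/-- `Φ` is Borel complete: for every sentence `Ψ` of `L'_{ω₁,ω}` in a countable language `L'`,
`(Mod(Ψ), ≅)` is Borel reducible to `(Mod(Φ), ≅)`. -/
def BorelComplete {L : FirstOrder.Language.{0, 0}} (Φ : InfSentence L (ℵ₁ : Cardinal.{0})) : Prop :=
  ∀ (L' : FirstOrder.Language.{0, 0}) (_ : Countable L'.Symbols) (Ψ : InfSentence L' (ℵ₁ : Cardinal.{0})),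
    BorelReducible Ψ Φ

/-! ### `λ`-Borel completeness -/

/-- The `λ⁺`-algebra of subsets of `Y` generated by `B`: the least family that contains `B` and is
closed under complements and under unions of at most `λ` members. -/
inductive LambdaBorel (lam : Cardinal.{u}) {Y : Type u} (B : Set (Set Y)) : Set Y → Prop
  | basic (U : Set Y) (hU : U ∈ B) : LambdaBorel lam B U
  | compl (U : Set Y) (hU : LambdaBorel lam B U) : LambdaBorel lam B Uᶜ
  | iUnion (ι : Type u) (hι : #ι ≤ lam) (U : ι → Set Y) (hU : ∀ i, LambdaBorel lam B (U i)) :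
      LambdaBorel lam B (⋃ i, U i)

/-- `Mod_λ(Φ)`: the models of `Φ` whose universe is the set of ordinals below `λ`. -/
abbrev ModLambda {L : FirstOrder.Language.{0, 0}} (lam : Cardinal.{u})
    (Φ : InfSentence L (ℵ₁ : Cardinal.{0})) : Type u :=
  Mod Φ lam.ord.ToType

/-- `(Mod_λ(Ψ), ≡_{∞,ω})` is `λ`-Borel reducible to `(Mod_λ(Φ), ≡_{∞,ω})`. -/
def LambdaBorelReducible {L' L : FirstOrder.Language.{0, 0}} (lam : Cardinal.{u})
    (Ψ : InfSentence L' (ℵ₁ : Cardinal.{0})) (Φ : InfSentence L (ℵ₁ : Cardinal.{0})) : Prop :=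
  ∃ f : ModLambda lam Ψ → ModLambda lam Φ,
    (∀ U ∈ Mod.subbasis Φ lam.ord.ToType,
      LambdaBorel lam (Mod.subbasis Ψ lam.ord.ToType) (f ⁻¹' U)) ∧
      ∀ M N : ModLambda lam Ψ, M.Equivalent N ↔ (f M).Equivalent (f N)

/-- `Φ` is `λ`-Borel complete: for every sentence `Ψ` of `L'_{ω₁,ω}` in a countable language `L'`,
`(Mod_λ(Ψ), ≡_{∞,ω})` is `λ`-Borel reducible to `(Mod_λ(Φ), ≡_{∞,ω})`. -/
def LambdaBorelComplete {L : FirstOrder.Language.{0, 0}} (lam : Cardinal.{u})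
    (Φ : InfSentence L (ℵ₁ : Cardinal.{0})) : Prop :=
  ∀ (L' : FirstOrder.Language.{0, 0}) (_ : Countable L'.Symbols) (Ψ : InfSentence L' (ℵ₁ : Cardinal.{0})),
    LambdaBorelReducible lam Ψ Φ

/-! ### Infinitely splitting, refining equivalence relations -/

/-- The relation symbols `E n`, all binary. -/
inductive RefRel : ℕ → Type
  | E (n : ℕ) : RefRel 2

/-- The language `{E_n : n ∈ ω}`. -/
def refLanguage : FirstOrder.Language.{0, 0} := ⟨fun _ => Empty, RefRel⟩

/-- The relation symbol `E_n`. -/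
def symE (n : ℕ) : refLanguage.Relations 2 := RefRel.E n

/-- `E_0` has a single class: `∀ x y, E_0(x, y)`. -/
def axTrivial : refLanguage.Sentence :=
  ((symE 0).boundedFormula₂ (&0) (&1) : refLanguage.BoundedFormula Empty 2).alls

/-- `E_{n+1}` refines `E_n`: `∀ x y, E_{n+1}(x, y) → E_n(x, y)`. -/
def axRefine (n : ℕ) : refLanguage.Sentence :=
  ((symE (n + 1)).boundedFormula₂ (&0) (&1) ⟹ (symE n).boundedFormula₂ (&0) (&1) :
    refLanguage.BoundedFormula Empty 2).alls

/-- Every `E_n`-class contains at least `k` classes of `E_{n+1}`: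
`∀ x, ∃ y_0 … y_{k-1}, ⋀_i E_n(x, y_i) ∧ ⋀_{i ≠ j} ¬ E_{n+1}(y_i, y_j)`. -/
noncomputable def axSplit (n k : ℕ) : refLanguage.Sentence :=
  Language.Formula.iAlls (α := Empty) (Fin 1) <|
    Language.Formula.iExs (α := Empty ⊕ Fin 1) (Fin k) <|
      (Language.Formula.iInf fun i : Fin k =>
        (symE n).formula₂ (Language.Term.var (Sum.inl (Sum.inr 0)))
          (Language.Term.var (Sum.inr i))) ⊓
      (Language.Formula.iInf fun p : {p : Fin k × Fin k // p.1 ≠ p.2} =>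
        ∼((symE (n + 1)).formula₂ (Language.Term.var (Sum.inr p.1.1))
          (Language.Term.var (Sum.inr p.1.2))))

/-- The first-order theory `REF(inf)`. -/
def refInfTheory : refLanguage.Theory :=
  {axTrivial} ∪ (Set.range fun n => (symE n).reflexive) ∪ (Set.range fun n => (symE n).symmetric) ∪
    (Set.range fun n => (symE n).transitive) ∪ Set.range axRefine ∪
    Set.range fun p : ℕ × ℕ => axSplit p.1 p.2

theorem countable_refInfTheory : refInfTheory.Countable := by
  unfold refInfTheory
  refine ((((Set.Countable.union ?_ ?_).union ?_).union ?_).union ?_).union ?_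
  · exact Set.countable_singleton _
  all_goals exact Set.countable_range _

/-- `REF(inf)` as a sentence of `L_{ω₁,ω}`. -/
noncomputable def refInf : InfSentence refLanguage (ℵ₁ : Cardinal.{0}) :=
  InfSentence.ofTheory refInfTheory countable_refInfTheory

section Meaning

open FirstOrder.Language

/-- The models of `refInf` are the infinitely splitting, refining equivalence relations. -/
theorem holds_refInf_iff (X : Type x) [refLanguage.Structure X] :
    refInf.Holds X ↔
      (∀ n, Equivalence fun a b : X => Structure.RelMap (symE n) ![a, b]) ∧
      (∀ a b : X, Structure.RelMap (symE 0) ![a, b]) ∧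
      (∀ n, ∀ a b : X, Structure.RelMap (symE (n + 1)) ![a, b] →
        Structure.RelMap (symE n) ![a, b]) ∧
      ∀ n k, ∀ a : X, ∃ b : Fin k → X, (∀ i, Structure.RelMap (symE n) ![a, b i]) ∧
        ∀ i j, i ≠ j → ¬ Structure.RelMap (symE (n + 1)) ![b i, b j] := by
  have h0 : X ⊨ axTrivial ↔ ∀ a b : X, Structure.RelMap (symE 0) ![a, b] := by
    simp only [axTrivial, Sentence.Realize, Formula.Realize, BoundedFormula.alls,
      BoundedFormula.realize_all, BoundedFormula.realize_rel₂]
    rfl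
  have h1 : ∀ n, X ⊨ axRefine n ↔ ∀ a b : X, Structure.RelMap (symE (n + 1)) ![a, b] →
        Structure.RelMap (symE n) ![a, b] := by
    intro n
    simp only [axRefine, Sentence.Realize, Formula.Realize, BoundedFormula.alls,
      BoundedFormula.realize_all, BoundedFormula.realize_rel₂, BoundedFormula.realize_imp]
    rfl
  have h2 : ∀ n k, X ⊨ axSplit n k ↔ ∀ a : X, ∃ b : Fin k → X,
      (∀ i, Structure.RelMap (symE n) ![a, b i]) ∧
        ∀ i j, i ≠ j → ¬ Structure.RelMap (symE (n + 1)) ![b i, b j] := by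
    intro n k
    simp only [axSplit, Sentence.Realize, Formula.realize_iAlls, Formula.realize_iExs,
      Formula.realize_inf, Formula.realize_iInf, Formula.realize_not, Formula.realize_rel₂,
      Term.realize_var, Sum.elim_inl, Sum.elim_inr, Subtype.forall, Prod.forall]
    constructor
    · intro h a
      exact h fun _ => a
    · intro h a
      exact h (a 0)
  simp only [refInf, InfSentence.holds_ofTheory, refInfTheory, Theory.model_union_iff]
  simp only [Theory.model_iff, Set.mem_singleton_iff, forall_eq, Set.forall_mem_range, h0, h1, h2,
    Prod.forall, Relations.realize_reflexive, Relations.realize_symmetric,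
    Relations.realize_transitive]
  constructor
  · rintro ⟨⟨⟨⟨⟨a, b⟩, c⟩, d⟩, e⟩, f⟩
    exact ⟨fun n => ⟨(b n).refl, fun {x y} => (c n).symm x y, fun {x y z} => (d n).trans x y z⟩, a, e, f⟩
  · rintro ⟨a, b, c, d⟩
    exact ⟨⟨⟨⟨⟨b, fun n => ⟨(a n).refl⟩⟩, fun n => ⟨fun _ _ => (a n).symm⟩⟩,
      fun n => ⟨fun _ _ _ => (a n).trans⟩⟩, c⟩, d⟩

end Meaning

end BorelComplexity

/-!
Colour the finite tuples of a structure by natural numbers which record, in binary, the truth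
values of the atomic formulas at the tuple; the colours are positive and grow strictly along the
tree of finite tuples, and back-and-forth systems between structures are the same as back-and-forth
systems between their coloured trees. A coloured tree is coded in a model of `REF(inf)` as follows.
Each element carries a walk in the tree that starts from the empty tuple and is eventually idle;
a move stays, dies, or appends an element to the tuple, and comes in infinitely many copies. A walk
that ends in a tuple is carried by as many elements as the colour of that tuple says, a walk that
dies by infinitely many, and `E_n` says that the first `n` moves agree. The number of elements
attached to the same walk recovers the colour, and the growth of colours makes moves visible: a
counterpart of a move that appends can neither stay (the colour would not grow) nor die (the
number would be infinite). Thus back-and-forth systems translate in both directions, and the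
theorems of Karp and Scott turn them into `≡_{∞,ω}` and, in the countable case, into isomorphism.

The universe of the coding model is the set of labelled walks, which does not depend on the coded
structure; labels beyond the colour are sent to one fixed dead walk. So the walk attached to an
element takes two values only, and which one depends measurably on the structure.
-/

namespace BorelComplexity

open FirstOrder.Language PiNat

/-! ### Back-and-forth systems -/

section BackForth

variable {M : Type*} {N : Type*}

/-- Relations between finite tuples from `M` and tuples of the same length from `N`. -/
abbrev TupleRel (M : Type*) (N : Type*) := ∀ ⦃n : ℕ⦄, (Fin n → M) → (Fin n → N) → Prop

/-- The relation `B` read from `N` to `M`. -/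
def TupleRel.flip (B : TupleRel M N) : TupleRel N M := fun _ b a => B a b

/-- `B` is a back-and-forth system all of whose pairs satisfy `P`. -/
structure IsBackForth (P B : TupleRel M N) : Prop where
  sub {n : ℕ} {a : Fin n → M} {b : Fin n → N} : B a b → P a b
  forth {n : ℕ} {a : Fin n → M} {b : Fin n → N} (h : B a b) (c : M) :
    ∃ d, B (Fin.snoc a c : Fin (n + 1) → M) (Fin.snoc b d)
  back {n : ℕ} {a : Fin n → M} {b : Fin n → N} (h : B a b) (d : N) :
    ∃ c, B (Fin.snoc a c : Fin (n + 1) → M) (Fin.snoc b d)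

/-- Some back-and-forth system whose pairs satisfy `P` relates the empty tuples. -/
def BackForth (P : TupleRel M N) : Prop :=
  ∃ B : TupleRel M N, IsBackForth P B ∧ B Fin.elim0 Fin.elim0

theorem IsBackForth.flip {P B : TupleRel M N} {Q : TupleRel N M} (h : IsBackForth P B)
    (hPQ : ∀ ⦃n⦄ ⦃a : Fin n → M⦄ ⦃b : Fin n → N⦄, P a b → Q b a) : IsBackForth Q B.flip where
  sub hab := hPQ (h.sub hab)
  forth hab := h.back hab
  back hab := h.forth hab

theorem IsBackForth.exists_append {P B : TupleRel M N} (h : IsBackForth P B) {n k : ℕ}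
    {a : Fin n → M} {b : Fin n → N} (hab : B a b) (z : Fin k → M) :
    ∃ w : Fin k → N, B (Fin.append a z) (Fin.append b w) := by
  induction k with
  | zero =>
    refine ⟨Fin.elim0, ?_⟩
    rw [Subsingleton.elim z Fin.elim0, Fin.append_elim0, Fin.append_elim0]
    exact hab
  | succ k ih =>
    obtain ⟨w, hw⟩ := ih (Fin.init z)
    obtain ⟨d, hd⟩ := h.forth hw (z (Fin.last k))
    refine ⟨Fin.snoc w d, ?_⟩
    rw [← Fin.append_snoc, ← Fin.append_snoc, Fin.snoc_init_self] at hd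
    exact hd

end BackForth

/-! ### Karp's theorem -/

section Karp

variable {L : FirstOrder.Language.{v, w}} {M : Type*} {N : Type*}

/-- Two tuples satisfy the same atomic formulas. -/
def AtomicEquiv (_ : L.Structure M) (_ : L.Structure N) : TupleRel M N :=
  fun n a b => ∀ θ : L.Formula (Fin n), θ.IsAtomic → (θ.Realize a ↔ θ.Realize b)

variable {SM : L.Structure M} {SN : L.Structure N}

theorem AtomicEquiv.symm {n : ℕ} {a : Fin n → M} {b : Fin n → N} (h : AtomicEquiv SM SN a b) :
    AtomicEquiv SN SM b a :=
  fun θ hθ => (h θ hθ).symm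

theorem AtomicEquiv.comp {n k : ℕ} {a : Fin n → M} {b : Fin n → N} (h : AtomicEquiv SM SN a b)
    (g : Fin k → Fin n) : AtomicEquiv SM SN (a ∘ g) (b ∘ g) := by
  intro θ hθ
  simpa only [Formula.realize_relabel] using h (θ.relabel g) (hθ.relabel _)

theorem sumElim_default {ι X : Type*} (c : ι → X) :
    (Sum.elim c default : ι ⊕ Fin 0 → X) = c ∘ Sum.elim id Fin.elim0 :=
  funext <| Sum.rec (fun _ => rfl) fun i => i.elim0

theorem atomicEquiv_iff {n : ℕ} {a : Fin n → M} {b : Fin n → N} :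
    AtomicEquiv SM SN a b ↔
      (∀ s t : L.Term (Fin n), s.realize a = t.realize a ↔ s.realize b = t.realize b) ∧
      ∀ (l : ℕ) (R : L.Relations l) (ts : Fin l → L.Term (Fin n)),
        (Structure.RelMap R fun i => (ts i).realize a) ↔
          Structure.RelMap R fun i => (ts i).realize b := by
  constructor
  · intro h
    exact ⟨fun s t => by simpa only [Formula.realize_equal] using h (s.equal t) (.equal _ _),
      fun l R ts => by simpa only [Formula.realize_rel] using h (R.formula ts) (.rel _ _)⟩
  · rintro ⟨hterm, hrel⟩ θ hθ
    cases hθ with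
    | equal s t =>
      simpa only [Formula.Realize, BoundedFormula.realize_bdEqual, sumElim_default,
        Term.realize_relabel] using
        hterm (s.relabel (Sum.elim id Fin.elim0)) (t.relabel (Sum.elim id Fin.elim0))
    | rel R ts =>
      simpa only [Formula.Realize, BoundedFormula.realize_rel, sumElim_default,
        Term.realize_relabel] using hrel _ R fun i => (ts i).relabel (Sum.elim id Fin.elim0)

theorem IsBackForth.realize_iff {B : TupleRel M N} (h : IsBackForth (AtomicEquiv SM SN) B)
    {κ : Cardinal.{x}} {n : ℕ} (φ : InfFormula L κ n) {a : Fin n → M} {b : Fin n → N}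
    (hab : B a b) : φ.Realize a ↔ φ.Realize b := by
  induction φ with
  | falsum => exact Iff.rfl
  | equal s t => exact (atomicEquiv_iff.1 (h.sub hab)).1 s t
  | rel R ts => exact (atomicEquiv_iff.1 (h.sub hab)).2 _ R ts
  | imp φ ψ ihφ ihψ => exact imp_congr (ihφ hab) (ihψ hab)
  | conj ι _ φ ih => exact forall_congr' fun i => ih i hab
  | all φ ih =>
    constructor
    · intro H d
      obtain ⟨c, hc⟩ := h.back hab d
      exact (ih hc).1 (H c)
    · intro H c
      obtain ⟨d, hd⟩ := h.forth hab c
      exact (ih hd).2 (H d)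

theorem exists_realize_iff_snoc {M : Type*} {N : Type u} {SM : L.Structure M}
    {SN : L.Structure N} {κ : Cardinal.{u}} (hN : #N < κ) {n : ℕ} {a : Fin n → M}
    {b : Fin n → N} (h : ∀ φ : InfFormula L κ n, φ.Realize a ↔ φ.Realize b) (c : M) :
    ∃ d : N, ∀ φ : InfFormula L κ (n + 1),
      φ.Realize (Fin.snoc a c : Fin (n + 1) → M) ↔ φ.Realize (Fin.snoc b d : Fin (n + 1) → N) := by
  by_contra! H
  have separating (d : N) : ∃ φ : InfFormula L κ (n + 1),
      φ.Realize (Fin.snoc a c : Fin (n + 1) → M) ∧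
        ¬ φ.Realize (Fin.snoc b d : Fin (n + 1) → N) := by
    obtain ⟨φ, ⟨ha, hb⟩ | ⟨ha, hb⟩⟩ := H d
    · exact ⟨φ, ha, hb⟩
    · exact ⟨.imp φ .falsum, ha, fun hb' => hb' hb⟩
  choose φ hφa hφb using separating
  let someExtension : InfFormula L κ n := .imp (.all (.imp (.conj N hN φ) .falsum)) .falsum
  have hsome : someExtension.Realize b := (h someExtension).1 fun hall => hall c hφa
  exact hsome fun d hd => hφb d (hd d)

theorem infEquiv_iff_backForth {L : FirstOrder.Language.{0, 0}} {M N : Type u}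
    {SM : L.Structure M} {SN : L.Structure N} :
    InfEquiv L M N ↔ BackForth (AtomicEquiv SM SN) := by
  constructor
  · intro h
    let κ : Cardinal.{u} := Order.succ (max #M #N)
    have hM : #M < κ := Order.lt_succ_of_le (le_max_left _ _)
    have hN : #N < κ := Order.lt_succ_of_le (le_max_right _ _)
    refine ⟨fun n a b => ∀ φ : InfFormula L κ n, φ.Realize a ↔ φ.Realize b,
      ⟨fun hab => ?_, fun hab c => exists_realize_iff_snoc hN hab c, fun hab d => ?_⟩, h κ⟩
    · exact atomicEquiv_iff.2 ⟨fun s t => hab (.equal s t), fun l R ts => hab (.rel R ts)⟩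
    · obtain ⟨c, hc⟩ := exists_realize_iff_snoc hM (fun φ => (hab φ).symm) d
      exact ⟨c, fun φ => (hc φ).symm⟩
  · rintro ⟨B, hB, h0⟩ κ φ
    exact hB.realize_iff φ h0

end Karp

/-! ### Scott's isomorphism theorem -/

theorem exists_seq_of_forall_exists_snoc {α : Type*} {Q : ∀ ⦃n : ℕ⦄, (Fin n → α) → Prop}
    {R : ℕ → α → Prop} (h0 : Q Fin.elim0)
    (hsnoc : ∀ ⦃n⦄ ⦃t : Fin n → α⦄, Q t → ∃ x, R n x ∧ Q (Fin.snoc t x : Fin (n + 1) → α)) :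
    ∃ f : ℕ → α, ∀ n, R n (f n) ∧ Q fun i : Fin n => f i := by
  choose! next hR hQ using hsnoc
  let F : ∀ n, {t : Fin n → α // Q t} := fun n =>
    Nat.rec ⟨Fin.elim0, h0⟩ (fun n t => ⟨_, hQ t.2⟩) n
  have F_eq (n : ℕ) : (F n).1 = fun i : Fin n => next (F i).2 := by
    induction n with
    | zero => exact Subsingleton.elim _ _
    | succ n ih =>
      refine funext (Fin.lastCases (Fin.snoc_last (α := fun _ => α) _ _) fun i => ?_)
      exact (Fin.snoc_castSucc (α := fun _ => α) _ _ i).trans (congrFun ih i)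
  exact ⟨fun n => next (F n).2, fun n => ⟨hR (F n).2, F_eq n ▸ (F n).2⟩⟩

theorem IsBackForth.exists_enumerations {M N : Type*} [Countable M] [Countable N] [Nonempty M]
    {P B : TupleRel M N} (h : IsBackForth P B) (h0 : B Fin.elim0 Fin.elim0) :
    ∃ (p : ℕ → M) (q : ℕ → N), p.Surjective ∧ q.Surjective ∧
      ∀ n, B (fun i : Fin n => p i) fun i => q i := by
  obtain ⟨e, he⟩ := exists_surjective_nat (M ⊕ N)
  obtain ⟨f, hf⟩ := exists_seq_of_forall_exists_snoc
    (Q := fun n (t : Fin n → M × N) => B (Prod.fst ∘ t) (Prod.snd ∘ t))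
    (R := fun n x => Sum.elim (x.1 = ·) (x.2 = ·) (e n))
    (by simpa only [Subsingleton.elim _ (Fin.elim0)] using h0) fun n t ht => by
      simp only [Fin.comp_snoc]
      rcases e n with c | d
      · obtain ⟨d, hd⟩ := h.forth ht c
        exact ⟨(c, d), rfl, hd⟩
      · obtain ⟨c, hc⟩ := h.back ht d
        exact ⟨(c, d), rfl, hc⟩
  refine ⟨fun n => (f n).1, fun n => (f n).2, fun c => ?_, fun d => ?_, fun n => (hf n).2⟩
  · obtain ⟨n, hn⟩ := he (.inl c)
    exact ⟨n, by simpa only [hn, Sum.elim_inl] using (hf n).1⟩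
  · obtain ⟨n, hn⟩ := he (.inr d)
    exact ⟨n, by simpa only [hn, Sum.elim_inr] using (hf n).1⟩

theorem exists_equiv_apply_eq {ι α β : Type*} {p : ι → α} {q : ι → β} (hp : p.Surjective)
    (hq : q.Surjective) (h : ∀ i j, p i = p j ↔ q i = q j) : ∃ e : α ≃ β, ∀ i, e (p i) = q i := by
  have surjInv_apply (i : ι) : q (Function.surjInv hp (p i)) = q i :=
    (h _ _).1 (Function.surjInv_eq hp _)
  refine ⟨Equiv.ofBijective (fun x => q (Function.surjInv hp x)) ⟨?_, fun y => ?_⟩,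
    surjInv_apply⟩
  · refine hp.forall₂.2 fun i j hij => (h i j).2 ?_
    simpa only [surjInv_apply] using hij
  · obtain ⟨i, rfl⟩ := hq y
    exact ⟨p i, surjInv_apply i⟩

section Scott

variable {L : FirstOrder.Language.{v, w}} {M : Type*} {N : Type*} {SM : L.Structure M}
  {SN : L.Structure N}

theorem nonempty_equiv_of_enumerations {p : ℕ → M} {q : ℕ → N} (hp : p.Surjective)
    (hq : q.Surjective) (h : ∀ n, AtomicEquiv SM SN (fun i : Fin n => p i) fun i => q i) :
    Nonempty (L.Equiv M N) := by
  have atomicEquiv_comp {l : ℕ} (g : Fin l → ℕ) : AtomicEquiv SM SN (p ∘ g) (q ∘ g) := by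
    have hg (i : Fin l) : g i < Finset.univ.sup g + 1 :=
      Nat.lt_succ_of_le (Finset.le_sup (Finset.mem_univ i))
    exact (h _).comp fun i => ⟨g i, hg i⟩
  obtain ⟨e, he⟩ := exists_equiv_apply_eq hp hq fun i j =>
    (atomicEquiv_iff.1 (atomicEquiv_comp ![i, j])).1 (.var 0) (.var 1)
  refine ⟨⟨e, fun {l} f x => ?_, fun {l} R x => ?_⟩⟩
  · obtain ⟨g, rfl⟩ := hp.comp_left x
    obtain ⟨k, hk⟩ := hp (Structure.funMap f (p ∘ g))
    have hfun := (atomicEquiv_iff.1 (atomicEquiv_comp (Fin.snoc g k : Fin (l + 1) → ℕ))).1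
      (.func f fun i => .var i.castSucc) (.var (Fin.last l))
    simp only [Term.realize, Function.comp_apply, Fin.snoc_castSucc, Fin.snoc_last, hk] at hfun
    change e (Structure.funMap f (p ∘ g)) = Structure.funMap f (e ∘ p ∘ g)
    rw [← hk, he]
    exact (hfun.1 rfl).symm.trans (congrArg _ (funext fun i => (he (g i)).symm))
  · obtain ⟨g, rfl⟩ := hp.comp_left x
    have hrel := (atomicEquiv_iff.1 (atomicEquiv_comp g)).2 l R .var
    change Structure.RelMap R (e ∘ p ∘ g) ↔ Structure.RelMap R (p ∘ g)
    rw [show e ∘ p ∘ g = q ∘ g from funext fun i => he (g i)]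
    exact hrel.symm

theorem nonempty_equiv_iff_backForth [Countable M] [Countable N] [Nonempty M] :
    Nonempty (L.Equiv M N) ↔ BackForth (AtomicEquiv SM SN) := by
  constructor
  · rintro ⟨e⟩
    refine ⟨fun n a b => b = e ∘ a, ⟨?_, ?_, ?_⟩, Subsingleton.elim _ _⟩
    · rintro n a b rfl
      refine atomicEquiv_iff.2 ⟨fun s t => ?_, fun l R ts => ?_⟩
      · rw [HomClass.realize_term, HomClass.realize_term, e.injective.eq_iff]
      · simp only [HomClass.realize_term]
        exact (e.map_rel R _).symm
    · rintro n a b rfl c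
      exact ⟨e c, (Fin.comp_snoc e a c).symm⟩
    · rintro n a b rfl d
      exact ⟨e.symm d, by rw [Fin.comp_snoc, e.apply_symm_apply]⟩
  · rintro ⟨B, hB, h0⟩
    obtain ⟨p, q, hp, hq, hpq⟩ := hB.exists_enumerations h0
    exact nonempty_equiv_of_enumerations hp hq fun n => hB.sub (hpq n)

end Scott

/-! ### Prefix structures -/

section PrefixStructure

variable {W : Type*} {W' : Type*} {Y : Type*} {Y' : Type*}

/-- The structure on `W` in which `E_n` says that the attached sequences agree in their first
`n` entries. -/
@[reducible]
def prefixStructure (sq : W → ℕ → Y) : refLanguage.Structure W where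
  funMap f := f.elim
  RelMap
    | RefRel.E n => fun a => res (sq (a 0)) n = res (sq (a 1)) n

variable {sq : W → ℕ → Y} {sq' : W' → ℕ → Y'}

theorem relMap_prefixStructure (n : ℕ) (a : Fin 2 → W) :
    (prefixStructure sq).RelMap (symE n) a ↔ res (sq (a 0)) n = res (sq (a 1)) n :=
  Iff.rfl

theorem holds_refInf_prefixStructure
    (h : ∀ w n, {y | ∃ v, res (sq v) (n + 1) = y :: res (sq w) n}.Infinite) :
    @InfSentence.Holds _ _ refInf W (prefixStructure sq) := by
  let _ := prefixStructure sq
  refine (holds_refInf_iff W).2 ⟨fun n => ⟨fun _ => rfl, Eq.symm, Eq.trans⟩, fun _ _ => rfl,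
    fun n a b hab => (List.cons.inj hab).2, fun n k a => ?_⟩
  let y := (h a n).natEmbedding
  choose v hv using fun i : Fin k => (y i).2
  refine ⟨v, fun i => ((List.cons.inj (hv i)).2).symm, fun i j hij hE => hij ?_⟩
  have hy : (y i : Y) :: res (sq a) n = (y j : Y) :: res (sq a) n :=
    (hv i).symm.trans (((relMap_prefixStructure _ _).1 hE).trans (hv j))
  exact Fin.ext (y.injective (Subtype.ext (List.cons.inj hy).1))

instance : refLanguage.IsRelational := fun _ => inferInstanceAs (IsEmpty Empty)

theorem exists_eq_var {L : FirstOrder.Language.{v, w}} [L.IsRelational] {α : Type*} :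
    ∀ t : L.Term α, ∃ i, t = .var i
  | .var i => ⟨i, rfl⟩
  | .func f _ => isEmptyElim f

theorem atomicEquiv_prefixStructure {n : ℕ} {a : Fin n → W} {b : Fin n → W'} :
    AtomicEquiv (prefixStructure sq) (prefixStructure sq') a b ↔
      (∀ i j, a i = a j ↔ b i = b j) ∧
      ∀ i j m, res (sq (a i)) m = res (sq (a j)) m ↔ res (sq' (b i)) m = res (sq' (b j)) m := by
  rw [atomicEquiv_iff]
  constructor
  · rintro ⟨hterm, hrel⟩
    exact ⟨fun i j => hterm (.var i) (.var j), fun i j m => hrel 2 (symE m) ![.var i, .var j]⟩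
  · rintro ⟨heq, hres⟩
    refine ⟨fun s t => ?_, fun l R ts => ?_⟩
    · obtain ⟨i, rfl⟩ := exists_eq_var s
      obtain ⟨j, rfl⟩ := exists_eq_var t
      exact heq i j
    · obtain ⟨m⟩ := R
      obtain ⟨i, hi⟩ := exists_eq_var (ts 0)
      obtain ⟨j, hj⟩ := exists_eq_var (ts 1)
      refine (relMap_prefixStructure m _).trans
        (Iff.trans ?_ (relMap_prefixStructure m _).symm)
      simp only [hi, hj]
      exact hres i j m

theorem forall_res_eq_res_iff {p q : ℕ → Y} : (∀ m, res p m = res q m) ↔ p = q :=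
  funext_iff.symm.trans res_injective.eq_iff

theorem natCast_le_encard_iff {α : Type*} {s : Set α} {k : ℕ} :
    (k : ℕ∞) ≤ s.encard ↔ ∃ z : Fin k → α, z.Injective ∧ ∀ i, z i ∈ s := by
  constructor
  · intro h
    obtain ⟨t, hts, ht⟩ := Set.exists_subset_encard_eq h
    lift t to Finset α using Set.finite_of_encard_eq_coe ht
    rw [Set.encard_coe_eq_coe_finsetCard, Nat.cast_inj] at ht
    let e := t.equivFinOfCardEq ht
    exact ⟨fun i => e.symm i, Subtype.val_injective.comp e.symm.injective,
      fun i => hts (e.symm i).2⟩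
  · rintro ⟨z, hz, hzs⟩
    calc (k : ℕ∞) = ENat.card (Fin k) := by
          simp only [ENat.card_eq_coe_fintype_card, Fintype.card_fin]
      _ ≤ (Set.range z).encard := hz.encard_range
      _ ≤ s.encard := Set.encard_le_encard (Set.range_subset_iff.2 hzs)

section Fibres

variable {B : TupleRel W W'} {n : ℕ} {a : Fin n → W} {b : Fin n → W'}

theorem encard_fibre_le_of_isBackForth
    (hB : IsBackForth (AtomicEquiv (prefixStructure sq) (prefixStructure sq')) B) (hab : B a b)
    (i : Fin n) : {v | sq v = sq (a i)}.encard ≤ {v | sq' v = sq' (b i)}.encard := by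
  refine ENat.forall_natCast_le_iff_le.1 fun k hk => ?_
  obtain ⟨z, hz, hza⟩ := natCast_le_encard_iff.1 hk
  obtain ⟨w, hw⟩ := hB.exists_append hab z
  obtain ⟨heq, hres⟩ := atomicEquiv_prefixStructure.1 (hB.sub hw)
  refine natCast_le_encard_iff.2 ⟨w, fun j l hjl => hz ?_, fun j => ?_⟩
  · have h := heq (Fin.natAdd n j) (Fin.natAdd n l)
    simp only [Fin.append_right] at h
    exact h.2 hjl
  · have h := hres (Fin.natAdd n j) (Fin.castAdd k i)
    simp only [Fin.append_right, Fin.append_left] at h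
    exact forall_res_eq_res_iff.1 fun m => (h m).1 (congrArg (res · m) (hza j))

theorem encard_fibre_eq_of_isBackForth
    (hB : IsBackForth (AtomicEquiv (prefixStructure sq) (prefixStructure sq')) B) (hab : B a b)
    (i : Fin n) : {v | sq v = sq (a i)}.encard = {v | sq' v = sq' (b i)}.encard :=
  (encard_fibre_le_of_isBackForth hB hab i).antisymm
    (encard_fibre_le_of_isBackForth (hB.flip fun _ _ _ => AtomicEquiv.symm) hab i)

end Fibres

end PrefixStructure

/-! ### Paths through the tree of finite tuples -/

section Path

variable {X : Type*}

/-- The nodes of the tree of finite tuples. -/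
abbrev Node (X : Type*) := Σ n : ℕ, Fin n → X

/-- The position of a walk in the tree of finite tuples; `none` is the dead state. -/
abbrev State (X : Type*) := Option (Node X)

/-- What a single move of a walk in the tree of finite tuples can do. -/
inductive Action (X : Type*)
  | stay
  | die
  | append (x : X)

instance : Zero (Action X) := ⟨.stay⟩

/-- An action together with a label that makes infinitely many copies of it; the idle move is
`0 = (stay, 0)`. -/
abbrev Move (X : Type*) := Action X × ℕ

/-- The walks that are idle from some time on. -/
abbrev Path (X : Type*) := ℕ →₀ Move X

/-- The effect of an action on a state. -/
def State.step : State X → Action X → State X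
  | none, _ => none
  | some t, .stay => some t
  | some _, .die => none
  | some ⟨n, t⟩, .append x => some ⟨n + 1, Fin.snoc t x⟩

/-- The state reached from the empty tuple by a list of moves, the last of which is the head of
the list, as in `PiNat.res`. -/
def stateOf : List (Move X) → State X :=
  List.foldr (fun y s => s.step y.1) (some ⟨0, Fin.elim0⟩)

theorem State.step_zero (s : State X) : s.step 0 = s := by
  rcases s with _ | t <;> rfl

theorem stateOf_cons (y : Move X) (l : List (Move X)) : stateOf (y :: l) = (stateOf l).step y.1 :=
  rfl

/-- A time from which on the path is idle. -/
def Path.level (p : Path X) : ℕ := p.support.sup Nat.succ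

/-- The state that the path ends up in. -/
def Path.final (p : Path X) : State X := stateOf (res p p.level)

theorem Path.level_le_iff {p : Path X} {n : ℕ} : p.level ≤ n ↔ ∀ m, n ≤ m → p m = 0 := by
  simp only [Path.level, Finset.sup_le_iff, Finsupp.mem_support_iff, Nat.succ_le_iff]
  exact forall_congr' fun m => by rw [not_imp_comm, not_lt]

theorem Path.stateOf_res_eq_final {p : Path X} {n : ℕ} (h : p.level ≤ n) :
    stateOf (res p n) = p.final := by
  induction n, h using Nat.le_induction with
  | base => rfl
  | succ n hn ih => rw [res_succ, stateOf_cons, level_le_iff.1 hn n le_rfl, Prod.fst_zero,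
      State.step_zero, ih]

theorem Path.eq_iff_forall_res {p q : Path X} : p = q ↔ ∀ m, res p m = res q m :=
  DFunLike.coe_fn_eq.symm.trans forall_res_eq_res_iff.symm

/-- Follow `p` for `n` moves, then make the move `y` and become idle. -/
noncomputable def branch (p : Path X) (n : ℕ) (y : Move X) : Path X :=
  (p.filter (· < n)).update n y

theorem res_branch (p : Path X) (n : ℕ) (y : Move X) :
    res (branch p n y) (n + 1) = y :: res p n := by
  rw [res_succ, branch, Finsupp.coe_update, Function.update_self, List.cons_inj_right, res_eq_res]
  intro m hm
  rw [Function.update_of_ne hm.ne, Finsupp.filter_apply_pos (· < n) p hm]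

theorem level_branch_le (p : Path X) (n : ℕ) (y : Move X) : (branch p n y).level ≤ n + 1 := by
  refine Path.level_le_iff.2 fun m hm => ?_
  rw [branch, Finsupp.coe_update, Function.update_of_ne (by lia),
    Finsupp.filter_apply_neg (· < n) p (by lia)]

theorem final_branch (p : Path X) (n : ℕ) (y : Move X) :
    (branch p n y).final = (stateOf (res p n)).step y.1 := by
  rw [← Path.stateOf_res_eq_final (level_branch_le p n y), res_branch, stateOf_cons]

/-- A path that dies with its first move. -/
noncomputable def deadPath (X : Type*) : Path X := branch 0 0 (.die, 0)

theorem final_deadPath : (deadPath X).final = none := final_branch _ _ _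

theorem mk_action [Infinite X] : #(Action X) = #X := by
  refine le_antisymm ?_ (mk_le_of_injective (f := Action.append) fun _ _ => Action.append.inj)
  have hsurj : Function.Surjective fun o : Option (Option X) =>
      o.elim Action.stay fun o => o.elim .die .append := by
    rintro (_ | _ | x)
    exacts [⟨none, rfl⟩, ⟨some none, rfl⟩, ⟨some (some x), rfl⟩]
  refine (mk_le_of_surjective hsurj).trans ?_
  simp only [mk_option, add_one_eq (aleph0_le_mk X), le_refl]

theorem mk_path_prod_nat [Infinite X] : #(Path X × ℕ) = #X := by
  have hX := aleph0_le_mk X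
  have hMove : #(Move X) = #X := by
    rw [mk_prod, mk_nat, lift_aleph0, lift_uzero, mk_action, mul_aleph0_eq hX]
  have : Infinite (Move X) := infinite_iff.2 (hMove ▸ hX)
  rw [mk_prod, mk_finsupp_lift_of_infinite', hMove, mk_nat, lift_aleph0, lift_uzero, lift_uzero,
    max_eq_right hX, mul_aleph0_eq hX]

/-- An enumeration, by the elements of an infinite set, of the labelled paths through the tree of
its finite tuples. -/
noncomputable def pathEquiv (X : Type*) [Infinite X] : X ≃ Path X × ℕ :=
  (Cardinal.eq.1 mk_path_prod_nat).some.symm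

end Path

/-! ### Codes -/

section Codes

variable {X : Type*} {W : Type*} {V : Type*}

/-- A colouring of the tree of finite tuples by positive numbers which increase along the tree. -/
structure IsGrowing (c : Node X → ℕ) : Prop where
  pos (t : Node X) : 0 < c t
  lt_snoc {n : ℕ} (t : Fin n → X) (x : X) : c ⟨n, t⟩ < c ⟨n + 1, Fin.snoc t x⟩

/-- The number of elements that carry a path with the given final state. -/
def State.weight (c : Node X → ℕ) : State X → ℕ∞
  | none => ⊤
  | some t => c t

/-- `sq` attaches each path to as many elements of `W` as the weight of its final state says. -/
def Codes (c : Node X → ℕ) (sq : W → Path X) : Prop :=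
  ∀ p, {w | sq w = p}.encard = p.final.weight c

/-- The structure in which `E_n` says that the attached paths agree in their first `n` moves. -/
abbrev pathStructure (sq : W → Path X) : refLanguage.Structure W :=
  prefixStructure fun w => ⇑(sq w)

/-- The path attached to a labelled path: as many labels as the weight of its final state are used
for the path itself, the spare ones are sent to a dead path, where they do no harm. -/
noncomputable def codePath (c : Node X → ℕ) (x : Path X × ℕ) : Path X :=
  if x.2 < x.1.final.weight c then x.1 else deadPath X

variable {c : Node X → ℕ} {sq : W → Path X}

theorem IsGrowing.weight_ne_zero (hc : IsGrowing c) : ∀ s : State X, s.weight c ≠ 0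
  | none => ENat.top_ne_zero
  | some t => Nat.cast_ne_zero.2 (hc.pos t).ne'

theorem Codes.surjective (hsq : Codes c sq) (hc : IsGrowing c) : sq.Surjective := fun p =>
  Set.encard_ne_zero.1 (hsq p ▸ hc.weight_ne_zero p.final)

theorem Codes.comp_equiv (hsq : Codes c sq) (e : V ≃ W) : Codes c (sq ∘ e) := fun p =>
  (Set.encard_preimage_of_bijective e.bijective _).trans (hsq p)

theorem Codes.holds_refInf (hsq : Codes c sq) (hc : IsGrowing c) :
    @InfSentence.Holds _ _ refInf W (pathStructure sq) := by
  refine holds_refInf_prefixStructure fun w n => Set.infinite_univ.mono fun y _ => ?_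
  obtain ⟨v, hv⟩ := hsq.surjective hc (branch (sq w) n y)
  exact ⟨v, by rw [hv, res_branch]⟩

theorem codes_codePath (c : Node X → ℕ) : Codes c (codePath c) := by
  intro p
  rcases hp : p.final with _ | t
  · refine Set.encard_eq_top (Set.infinite_of_injective_forall_mem (f := Prod.mk p)
      (Prod.mk_right_injective p) fun i => if_pos ?_)
    simp only [hp, State.weight, ENat.natCast_lt_top]
  · have dead_ne : deadPath X ≠ p := by
      rintro rfl
      simp only [final_deadPath, reduceCtorEq] at hp
    have fibre_eq : {x | codePath c x = p} = Prod.mk p '' {i : ℕ | i < c t} := by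
      ext ⟨q, i⟩
      simp only [codePath, Set.mem_ofPred_eq, Set.mem_image, Prod.mk.injEq, ite_eq_iff, dead_ne,
        and_false, or_false]
      constructor
      · rintro ⟨hi, rfl⟩
        exact ⟨i, by simpa only [hp, State.weight, Nat.cast_lt] using hi, rfl, rfl⟩
      · rintro ⟨i, hi, rfl, rfl⟩
        exact ⟨by simpa only [hp, State.weight, Nat.cast_lt] using hi, rfl⟩
    rw [fibre_eq, (Prod.mk_right_injective p).encard_image, Set.Nat.encard_range, State.weight]

end Codes

/-! ### From tuples to structures -/

theorem res_eq_res_of_le {Y : Type*} {p q : ℕ → Y} {m n : ℕ} (h : res p n = res q n)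
    (hmn : m ≤ n) : res p m = res q m :=
  res_eq_res.2 fun _ hi => res_eq_res.1 h (hi.trans_le hmn)

theorem exists_first_split {Y : Type*} {k : ℕ} {f : Fin k → ℕ → Y} {p : ℕ → Y}
    (h : ∀ i, f i ≠ p) :
    ∃ N, (∀ i, res (f i) (N + 1) ≠ res p (N + 1)) ∧ (N = 0 ∨ ∃ i, res (f i) N = res p N) := by
  classical
  have split : ∃ N, ∀ i, res (f i) (N + 1) ≠ res p (N + 1) := by
    choose d hd using fun i => not_forall.1 (mt forall_res_eq_res_iff.1 (h i))
    exact ⟨Finset.univ.sup d, fun i hi => hd i <|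
      res_eq_res_of_le hi (Nat.le_succ_of_le (Finset.le_sup (Finset.mem_univ i)))⟩
  refine ⟨Nat.find split, Nat.find_spec split, ?_⟩
  rcases hN : Nat.find split with _ | M
  · exact .inl rfl
  · exact .inr (by simpa only [not_forall, not_not] using Nat.find_min split (m := M) (by lia))

theorem exists_mem_forall_ne_of_encard_eq {α β : Type*} {k : ℕ} {a : Fin k → α} {b : Fin k → β}
    {s : Set α} {t : Set β} (heq : ∀ i j, a i = a j ↔ b i = b j) (hmem : ∀ i, b i ∈ t → a i ∈ s)
    (hcard : s.encard = t.encard) {x : α} (hx : x ∈ s) (hxa : ∀ i, a i ≠ x) :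
    ∃ y ∈ t, ∀ i, b i ≠ y := by
  let I : Set (Fin k) := {i | a i ∈ s}
  obtain ⟨y₀, -⟩ : t.Nonempty := by
    rw [← Set.encard_pos, ← hcard, Set.encard_pos]
    exact ⟨x, hx⟩
  have hfac : b.FactorsThrough a := fun i j => (heq i j).1
  have image_eq : Function.extend a b (fun _ => y₀) '' (a '' I) = b '' I := by
    rw [← Set.image_comp]
    exact Set.image_congr fun i _ => hfac.extend_apply _ i
  have ssubset : a '' I ⊂ s := by
    refine (Set.ssubset_iff_of_subset (Set.image_subset_iff.2 fun _ hi => hi)).2 ⟨x, hx, ?_⟩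
    rintro ⟨i, -, hi⟩
    exact hxa i hi
  have encard_lt : (b '' I).encard < t.encard :=
    calc (b '' I).encard ≤ (a '' I).encard := image_eq ▸ Set.encard_image_le _ _
      _ < s.encard := (Set.toFinite (a '' I)).encard_lt_encard ssubset
      _ = t.encard := hcard
  obtain ⟨y, hyt, hy⟩ := Set.not_subset.1 (mt Set.encard_le_encard encard_lt.not_ge)
  exact ⟨y, hyt, fun i hi => hy ⟨i, hmem i (hi ▸ hyt), hi⟩⟩

section Forward

variable {X : Type*} {X' : Type*} {W : Type*} {W' : Type*}

/-- Tuples of the same colour. -/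
def SameColour (c : Node X → ℕ) (c' : Node X' → ℕ) : TupleRel X X' :=
  fun n s t => c ⟨n, s⟩ = c' ⟨n, t⟩

/-- Two states are both dead, or both are tuples and these are related. -/
inductive StateRel (B : TupleRel X X') : State X → State X' → Prop
  | dead : StateRel B none none
  | node {n : ℕ} {s : Fin n → X} {t : Fin n → X'} (h : B s t) :
    StateRel B (some ⟨n, s⟩) (some ⟨n, t⟩)

/-- The states of the paths are related during their first `n` moves. -/
def Follows (B : TupleRel X X') (n : ℕ) (p : Path X) (q : Path X') : Prop :=
  ∀ m ≤ n, StateRel B (stateOf (res p m)) (stateOf (res q m))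

variable {B : TupleRel X X'} {P : TupleRel X X'} {c : Node X → ℕ} {c' : Node X' → ℕ}

theorem StateRel.flip {s : State X} {t : State X'} : StateRel B s t → StateRel B.flip t s
  | .dead => .dead
  | .node h => .node h

theorem StateRel.weight_eq (hB : IsBackForth (SameColour c c') B) {s : State X} {t : State X'} :
    StateRel B s t → s.weight c = t.weight c'
  | .dead => rfl
  | .node h => congrArg Nat.cast (hB.sub h)

theorem StateRel.exists_step (hB : IsBackForth P B) {s : State X} {t : State X'}
    (h : StateRel B s t) (y : Action X) : ∃ z, StateRel B (s.step y) (t.step z) := by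
  rcases h with _ | h
  · exact ⟨.stay, .dead⟩
  · rcases y with _ | _ | x
    · exact ⟨.stay, .node h⟩
    · exact ⟨.die, .dead⟩
    · obtain ⟨x', hx⟩ := hB.forth h x
      exact ⟨.append x', .node hx⟩

section Follows

variable {n : ℕ} {p : Path X} {q : Path X'}

theorem Follows.flip (h : Follows B n p q) : Follows B.flip n q p :=
  fun m hm => (h m hm).flip

theorem Follows.congr {p' : Path X} {q' : Path X'} (h : Follows B n p q)
    (hp : res p n = res p' n) (hq : res q n = res q' n) : Follows B n p' q' := fun m hm => by
  rw [← res_eq_res_of_le hp hm, ← res_eq_res_of_le hq hm]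
  exact h m hm

theorem Follows.exists_branch (hB : IsBackForth P B) (h : Follows B n p q) :
    ∃ z, ∀ i, Follows B (n + 1) p (branch q n (z, i)) := by
  obtain ⟨z, hz⟩ := (h n le_rfl).exists_step hB (p n).1
  refine ⟨z, fun i m hm => ?_⟩
  have hres := res_branch q n (z, i)
  rcases hm.lt_or_eq with hm | rfl
  · exact h.congr rfl (List.cons.inj hres).2.symm m (Nat.le_of_lt_succ hm)
  · rwa [res_succ, stateOf_cons, hres, stateOf_cons]

theorem Follows.exists_extension (hB : IsBackForth P B) (h : Follows B n p q) (hq : q.level ≤ n) :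
    ∃ r : Path X', res r n = res q n ∧ ∀ m, Follows B m p r := by
  induction hk : p.level - n generalizing n q with
  | zero =>
    have final_rel : StateRel B p.final q.final := by
      rw [← Path.stateOf_res_eq_final (Nat.le_of_sub_eq_zero hk), ← Path.stateOf_res_eq_final hq]
      exact h n le_rfl
    refine ⟨q, rfl, fun _ m _ => ?_⟩
    rcases le_total m n with hm | hm
    · exact h m hm
    · rwa [Path.stateOf_res_eq_final ((Nat.le_of_sub_eq_zero hk).trans hm),
        Path.stateOf_res_eq_final (hq.trans hm)]
  | succ k ih =>
    obtain ⟨z, hz⟩ := h.exists_branch hB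
    obtain ⟨r, hr, hpr⟩ := ih (hz 0) (level_branch_le _ _ _) (by lia)
    exact ⟨r, (List.cons.inj (hr.trans (res_branch _ _ _))).2, hpr⟩

theorem Follows.exists_fresh_extension (hB : IsBackForth P B) (h : Follows B n p q)
    {F : Set (Move X')} (hF : F.Finite) :
    ∃ r : Path X', res r n = res q n ∧ r n ∉ F ∧ ∀ m, Follows B m p r := by
  obtain ⟨z, hz⟩ := h.exists_branch hB
  obtain ⟨i, hi⟩ := (hF.preimage (Prod.mk_right_injective z).injOn).exists_notMem
  obtain ⟨r, hr, hpr⟩ := (hz i).exists_extension hB (level_branch_le _ _ _)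
  obtain ⟨hrn, hres⟩ := List.cons.inj (hr.trans (res_branch q n (z, i)))
  exact ⟨r, hres, hrn ▸ hi, hpr⟩

end Follows

/-- Tuples of elements with the same pattern of equality and of agreement of the attached paths,
whose attached paths run through related states. -/
structure PatternRel (sq : W → Path X) (sq' : W' → Path X') (B : TupleRel X X') ⦃k : ℕ⦄
    (a : Fin k → W) (b : Fin k → W') : Prop where
  eq_iff (i j : Fin k) : a i = a j ↔ b i = b j
  res_iff (i j : Fin k) (m : ℕ) :
    res (sq (a i)) m = res (sq (a j)) m ↔ res (sq' (b i)) m = res (sq' (b j)) m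
  follows (i : Fin k) (n : ℕ) : Follows B n (sq (a i)) (sq' (b i))

variable {sq : W → Path X} {sq' : W' → Path X'}

namespace PatternRel

variable {k : ℕ} {a : Fin k → W} {b : Fin k → W'}

theorem flip (h : PatternRel sq sq' B a b) : PatternRel sq' sq B.flip b a :=
  ⟨fun i j => (h.eq_iff i j).symm, fun i j m => (h.res_iff i j m).symm,
    fun i n => (h.follows i n).flip⟩

theorem snoc (h : PatternRel sq sq' B a b) {x : W} {y : W'} (heq : ∀ j, a j = x ↔ b j = y)
    (hres : ∀ j m, res (sq (a j)) m = res (sq x) m ↔ res (sq' (b j)) m = res (sq' y) m)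
    (hfollows : ∀ n, Follows B n (sq x) (sq' y)) :
    PatternRel sq sq' B (Fin.snoc a x : Fin (k + 1) → W) (Fin.snoc b y) := by
  refine ⟨?_, ?_, ?_⟩ <;>
    simp only [Fin.forall_fin_succ', Fin.snoc_castSucc, Fin.snoc_last, implies_true, and_true]
  · exact ⟨fun i => ⟨h.eq_iff i, heq i⟩, fun i => by rw [eq_comm, heq i, eq_comm]⟩
  · exact ⟨fun i => ⟨h.res_iff i, hres i⟩, fun i m => by rw [eq_comm, hres i m, eq_comm]⟩
  · exact ⟨h.follows, hfollows⟩

theorem path_eq_iff (h : PatternRel sq sq' B a b) (i j : Fin k) :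
    sq (a i) = sq (a j) ↔ sq' (b i) = sq' (b j) := by
  rw [Path.eq_iff_forall_res, Path.eq_iff_forall_res]
  exact forall_congr' (h.res_iff i j)

theorem encard_fibre_eq (hB : IsBackForth (SameColour c c') B) (hsq : Codes c sq)
    (hsq' : Codes c' sq') (h : PatternRel sq sq' B a b) (i : Fin k) :
    {v | sq v = sq (a i)}.encard = {v | sq' v = sq' (b i)}.encard := by
  let n := max (sq (a i)).level (sq' (b i)).level
  rw [hsq, hsq', ← Path.stateOf_res_eq_final (le_max_left _ _ : _ ≤ n),
    ← Path.stateOf_res_eq_final (le_max_right _ _ : _ ≤ n)]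
  exact (h.follows i n n le_rfl).weight_eq hB

theorem exists_new_of_path_eq (hB : IsBackForth (SameColour c c') B) (hsq : Codes c sq)
    (hsq' : Codes c' sq') (h : PatternRel sq sq' B a b) {x : W} {i : Fin k}
    (hx : sq x = sq (a i)) (hxa : ∀ j, a j ≠ x) :
    ∃ y, sq' y = sq' (b i) ∧ ∀ j, b j ≠ y :=
  exists_mem_forall_ne_of_encard_eq (s := {v | sq v = sq (a i)}) (t := {v | sq' v = sq' (b i)})
    h.eq_iff (fun j => (h.path_eq_iff j i).2)
    (h.encard_fibre_eq hB hsq hsq' i) hx hxa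

theorem exists_follows_of_path_ne (hB : IsBackForth P B) (h0 : B Fin.elim0 Fin.elim0)
    (h : PatternRel sq sq' B a b) {p : Path X} (hp : ∀ i, sq (a i) ≠ p) :
    ∃ r : Path X', (∀ j m, res (sq (a j)) m = res p m ↔ res (sq' (b j)) m = res r m) ∧
      ∀ n, Follows B n p r := by
  obtain ⟨N, hsplit, hN⟩ :=
    exists_first_split fun i => mt (DFunLike.coe_fn_eq (F := Path X)).1 (hp i)
  obtain ⟨q, hpq, hq⟩ : ∃ q : Path X', Follows B N p q ∧
      ∀ j, ∀ m ≤ N, res (sq (a j)) m = res p m ↔ res (sq' (b j)) m = res q m := by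
    rcases hN with rfl | ⟨i, hi⟩
    · refine ⟨0, fun m hm => ?_, fun j m hm => ?_⟩ <;> obtain rfl := Nat.le_zero.1 hm
      · exact .node h0
      · exact iff_of_true rfl rfl
    · refine ⟨sq' (b i), (h.follows i N).congr hi rfl, fun j m hm => ?_⟩
      rw [← res_eq_res_of_le hi hm]
      exact h.res_iff j i m
  obtain ⟨r, hqr, hfresh, hpr⟩ :=
    hpq.exists_fresh_extension hB (Set.finite_range fun j => sq' (b j) N)
  refine ⟨r, fun j m => ?_, hpr⟩
  rcases le_or_gt m N with hm | hm
  · rw [hq j m hm, res_eq_res_of_le hqr hm]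
  · exact iff_of_false (fun H => hsplit j (res_eq_res_of_le H hm))
      fun H => hfresh ⟨j, res_eq_res.1 H hm⟩

theorem exists_snoc (hB : IsBackForth (SameColour c c') B) (h0 : B Fin.elim0 Fin.elim0)
    (hc' : IsGrowing c') (hsq : Codes c sq) (hsq' : Codes c' sq') (h : PatternRel sq sq' B a b)
    (x : W) : ∃ y, PatternRel sq sq' B (Fin.snoc a x : Fin (k + 1) → W) (Fin.snoc b y) := by
  by_cases hpath : ∃ i, sq x = sq (a i)
  · obtain ⟨i, hi⟩ := hpath
    by_cases hxa : ∃ j, a j = x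
    · obtain ⟨j, rfl⟩ := hxa
      exact ⟨b j, h.snoc (fun l => h.eq_iff l j) (fun l => h.res_iff l j) (h.follows j)⟩
    · push Not at hxa
      obtain ⟨y, hy, hyb⟩ := h.exists_new_of_path_eq hB hsq hsq' hi hxa
      refine ⟨y, h.snoc (fun l => iff_of_false (hxa l) (hyb l)) ?_ ?_⟩
      · simpa only [hi, hy] using fun l => h.res_iff l i
      · simpa only [hi, hy] using h.follows i
  · push Not at hpath
    obtain ⟨r, hres, hfollows⟩ :=
      h.exists_follows_of_path_ne hB h0 (p := sq x) fun i => (hpath i).symm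
    obtain ⟨y, rfl⟩ := hsq'.surjective hc' r
    refine ⟨y, h.snoc (fun j => iff_of_false ?_ ?_) hres hfollows⟩
    · rintro rfl
      exact hpath j rfl
    · rintro rfl
      exact hpath j (Path.eq_iff_forall_res.2 fun m => (hres j m).2 rfl).symm

end PatternRel

theorem backForth_pathStructure (hsq : Codes c sq) (hsq' : Codes c' sq') (hc : IsGrowing c)
    (hc' : IsGrowing c') (h : BackForth (SameColour c c')) :
    BackForth (AtomicEquiv (pathStructure sq) (pathStructure sq')) := by
  obtain ⟨B, hB, h0⟩ := h
  have hBflip : IsBackForth (SameColour c' c) B.flip := hB.flip fun _ _ _ => Eq.symm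
  refine ⟨PatternRel sq sq' B,
    ⟨fun hab => atomicEquiv_prefixStructure.2 ⟨hab.eq_iff, hab.res_iff⟩,
      fun hab => hab.exists_snoc hB h0 hc' hsq hsq', fun hab y => ?_⟩,
    ⟨fun i => i.elim0, fun i => i.elim0, fun i => i.elim0⟩⟩
  obtain ⟨x, hx⟩ := hab.flip.exists_snoc hBflip h0 hc hsq' hsq y
  exact ⟨x, hx.flip⟩

end Forward

/-! ### From structures to tuples -/

section Backward

variable {X : Type*} {X' : Type*} {W : Type*} {W' : Type*}
  {c : Node X → ℕ} {c' : Node X' → ℕ} {sq : W → Path X} {sq' : W' → Path X'} {B : TupleRel W W'}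

theorem State.exists_step_eq_snoc {n : ℕ} {t : Fin n → X} {y : Action X}
    (hlt : (c ⟨n, t⟩ : ℕ∞) < (State.step (some ⟨n, t⟩) y).weight c)
    (hfin : (State.step (some ⟨n, t⟩) y).weight c ≠ ⊤) :
    ∃ x, State.step (some ⟨n, t⟩) y = some ⟨n + 1, Fin.snoc t x⟩ :=
  match y with
  | .stay => (lt_irrefl _ hlt).elim
  | .die => (hfin rfl).elim
  | .append x => ⟨x, rfl⟩

theorem IsGrowing.weight_le_weight_step (hc : IsGrowing c) :
    ∀ (s : State X) (y : Action X), s.weight c ≤ (s.step y).weight c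
  | none, _ => le_rfl
  | some _, .stay => le_rfl
  | some _, .die => le_top
  | some ⟨_, t⟩, .append x => Nat.cast_le.2 (hc.lt_snoc t x).le

theorem IsGrowing.monotone_weight_stateOf_res (hc : IsGrowing c) (p : ℕ → Move X) :
    Monotone fun m => (stateOf (res p m)).weight c :=
  monotone_nat_of_le_succ fun _ => hc.weight_le_weight_step _ _

theorem Codes.weight_stateOf_res_le_encard (hsq : Codes c sq) (hc : IsGrowing c) (w : W) (m : ℕ) :
    (stateOf (res (sq w) m)).weight c ≤ {v | sq v = sq w}.encard := by
  rw [hsq, ← Path.stateOf_res_eq_final (le_max_right m (sq w).level)]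
  exact hc.monotone_weight_stateOf_res _ (le_max_left _ _)

section Weight

variable {k : ℕ} {a : Fin k → W} {b : Fin k → W'}

theorem Codes.exists_forth_branch (hsq : Codes c sq) (hc : IsGrowing c)
    (hB : IsBackForth (AtomicEquiv (pathStructure sq) (pathStructure sq')) B) (hab : B a b)
    (i : Fin k) (m : ℕ) (y : Move X) :
    ∃ v v', B (Fin.snoc a v : Fin (k + 1) → W) (Fin.snoc b v') ∧ sq v = branch (sq (a i)) m y ∧
      res (sq' v') m = res (sq' (b i)) m := by
  obtain ⟨v, hv⟩ := hsq.surjective hc (branch (sq (a i)) m y)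
  obtain ⟨v', hv'⟩ := hB.forth hab v
  have hres := ((atomicEquiv_prefixStructure.1 (hB.sub hv')).2 (Fin.last k) i.castSucc m).1
  simp only [Fin.snoc_last, Fin.snoc_castSucc] at hres
  exact ⟨v, v', hv', hv, hres (hv ▸ (List.cons.inj (res_branch _ _ _)).2)⟩

/- The path that idles after `m` moves is carried by as many elements as the weight of its state
at time `m` says, and this number is preserved by back-and-forth systems. -/
theorem weight_stateOf_res_le_of_isBackForth (hsq : Codes c sq) (hsq' : Codes c' sq')
    (hc : IsGrowing c) (hc' : IsGrowing c')
    (hB : IsBackForth (AtomicEquiv (pathStructure sq) (pathStructure sq')) B) (hab : B a b)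
    (i : Fin k) (m : ℕ) :
    (stateOf (res (sq' (b i)) m)).weight c' ≤ (stateOf (res (sq (a i)) m)).weight c := by
  obtain ⟨v, v', hvv', hv, hv'⟩ := hsq.exists_forth_branch hc hB hab i m 0
  have hcard : {w | sq w = sq v}.encard = {w | sq' w = sq' v'}.encard := by
    simpa only [Fin.snoc_last, DFunLike.coe_fn_eq] using
      encard_fibre_eq_of_isBackForth hB hvv' (Fin.last k)
  calc (stateOf (res (sq' (b i)) m)).weight c'
    _ = (stateOf (res (sq' v') m)).weight c' := by rw [hv']
    _ ≤ {w | sq' w = sq' v'}.encard := hsq'.weight_stateOf_res_le_encard hc' v' m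
    _ = {w | sq w = sq v}.encard := hcard.symm
    _ = (stateOf (res (sq (a i)) m)).weight c := by
      rw [hsq, hv, final_branch, Prod.fst_zero, State.step_zero]

theorem weight_stateOf_res_eq_of_isBackForth (hsq : Codes c sq) (hsq' : Codes c' sq')
    (hc : IsGrowing c) (hc' : IsGrowing c')
    (hB : IsBackForth (AtomicEquiv (pathStructure sq) (pathStructure sq')) B) (hab : B a b)
    (i : Fin k) (m : ℕ) :
    (stateOf (res (sq (a i)) m)).weight c = (stateOf (res (sq' (b i)) m)).weight c' :=
  (weight_stateOf_res_le_of_isBackForth hsq' hsq hc' hc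
    (hB.flip fun _ _ _ => AtomicEquiv.symm) hab i m).antisymm
    (weight_stateOf_res_le_of_isBackForth hsq hsq' hc hc' hB hab i m)

end Weight

/-- Tuples that the paths attached to related elements reach at the same time. -/
def ReachRel (sq : W → Path X) (sq' : W' → Path X') (B : TupleRel W W') : TupleRel X X' :=
  fun n s t => ∃ (k : ℕ) (a : Fin k → W) (b : Fin k → W') (i : Fin k) (m : ℕ), B a b ∧
    stateOf (res (sq (a i)) m) = some ⟨n, s⟩ ∧ stateOf (res (sq' (b i)) m) = some ⟨n, t⟩

namespace ReachRel

variable {n : ℕ} {s : Fin n → X} {t : Fin n → X'}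

theorem flip (h : ReachRel sq sq' B s t) : ReachRel sq' sq B.flip t s := by
  obtain ⟨k, a, b, i, m, hab, hs, ht⟩ := h
  exact ⟨k, b, a, i, m, hab, ht, hs⟩

theorem sameColour (hsq : Codes c sq) (hsq' : Codes c' sq') (hc : IsGrowing c)
    (hc' : IsGrowing c') (hB : IsBackForth (AtomicEquiv (pathStructure sq) (pathStructure sq')) B)
    (h : ReachRel sq sq' B s t) : SameColour c c' s t := by
  obtain ⟨k, a, b, i, m, hab, hs, ht⟩ := h
  have hweight := weight_stateOf_res_eq_of_isBackForth hsq hsq' hc hc' hB hab i m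
  rw [hs, ht] at hweight
  exact Nat.cast_injective hweight

/- Let an element make the move `append x`. The move of its counterpart leads to a state of the
same weight, which is finite, so that the counterpart does not die, and larger than the weight
before the move, so that the counterpart does not stay. -/
theorem exists_snoc (hsq : Codes c sq) (hsq' : Codes c' sq') (hc : IsGrowing c)
    (hc' : IsGrowing c') (hB : IsBackForth (AtomicEquiv (pathStructure sq) (pathStructure sq')) B)
    (h : ReachRel sq sq' B s t) (x : X) :
    ∃ x', ReachRel sq sq' B (Fin.snoc s x : Fin (n + 1) → X) (Fin.snoc t x') := by
  have hcolour : c ⟨n, s⟩ = c' ⟨n, t⟩ := h.sameColour hsq hsq' hc hc' hB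
  obtain ⟨k, a, b, i, m, hab, hs, ht⟩ := h
  obtain ⟨v, v', hvv', hv, hv'⟩ := hsq.exists_forth_branch hc hB hab i m (.append x, 0)
  have hstate : stateOf (res (sq v) (m + 1)) = some ⟨n + 1, Fin.snoc s x⟩ := by
    rw [hv, res_branch, stateOf_cons, hs, State.step]
  have hstate' : stateOf (res (sq' v') (m + 1)) = State.step (some ⟨n, t⟩) (sq' v' m).1 := by
    rw [res_succ, stateOf_cons, hv', ht]
  have hweight : (State.step (some ⟨n, t⟩) (sq' v' m).1).weight c' =
      (c ⟨n + 1, Fin.snoc s x⟩ : ℕ∞) := by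
    have := weight_stateOf_res_eq_of_isBackForth hsq hsq' hc hc' hB hvv' (Fin.last k) (m + 1)
    simpa only [Fin.snoc_last, hstate, hstate', State.weight] using this.symm
  obtain ⟨x', hx'⟩ := State.exists_step_eq_snoc (c := c') (t := t) (y := (sq' v' m).1)
    (by rw [hweight, ← hcolour]; exact Nat.cast_lt.2 (hc.lt_snoc s x))
    (hweight ▸ ENat.natCast_ne_top _)
  refine ⟨x', k + 1, _, _, Fin.last k, m + 1, hvv', ?_, ?_⟩
  · rw [Fin.snoc_last, hstate]
  · rw [Fin.snoc_last, hstate', hx']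

end ReachRel

theorem backForth_sameColour (hsq : Codes c sq) (hsq' : Codes c' sq') (hc : IsGrowing c)
    (hc' : IsGrowing c')
    (h : BackForth (AtomicEquiv (pathStructure sq) (pathStructure sq'))) :
    BackForth (SameColour c c') := by
  obtain ⟨B, hB, h0⟩ := h
  refine ⟨ReachRel sq sq' B,
    ⟨fun h => h.sameColour hsq hsq' hc hc' hB, fun h => h.exists_snoc hsq hsq' hc hc' hB,
      fun h y => ?_⟩, ?_⟩
  · obtain ⟨x, hx⟩ := h.flip.exists_snoc hsq' hsq hc' hc (hB.flip fun _ _ _ => AtomicEquiv.symm) y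
    exact ⟨x, hx.flip⟩
  · obtain ⟨v, -⟩ := hsq.surjective hc 0
    obtain ⟨v', hv⟩ := hB.forth h0 v
    exact ⟨1, _, _, 0, 0, hv, rfl, rfl⟩

theorem backForth_pathStructure_iff (hsq : Codes c sq) (hsq' : Codes c' sq') (hc : IsGrowing c)
    (hc' : IsGrowing c') :
    BackForth (AtomicEquiv (pathStructure sq) (pathStructure sq')) ↔
      BackForth (SameColour c c') :=
  ⟨backForth_sameColour hsq hsq' hc hc', backForth_pathStructure hsq hsq' hc hc'⟩

end Backward

/-! ### The colouring attached to a structure -/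

section Colouring

variable {L : FirstOrder.Language.{v, w}} {X : Type*} {X' : Type*}

/-- A sequence of atomic formulas, the `m`-th one in the variables `x_0, …, x_m`, which lists each
atomic formula up to dummy variables. -/
structure IsAtomicEnumeration (enum : ∀ m, L.Formula (Fin (m + 1))) : Prop where
  isAtomic (m : ℕ) : (enum m).IsAtomic
  exists_eq {n : ℕ} (θ : L.Formula (Fin n)) (hθ : θ.IsAtomic) :
    ∃ k, enum (n + k) = θ.relabel (Fin.castAdd (k + 1))

theorem exists_isAtomicEnumeration (L : FirstOrder.Language.{v, w}) [Countable L.Symbols] :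
    ∃ enum : ∀ m, L.Formula (Fin (m + 1)), IsAtomicEnumeration enum := by
  have : Nonempty (Σ n, {θ : L.Formula (Fin n) // θ.IsAtomic}) :=
    ⟨1, (Term.var 0).equal (Term.var 0), .equal _ _⟩
  obtain ⟨f, hf⟩ := exists_surjective_nat (Σ n, {θ : L.Formula (Fin n) // θ.IsAtomic})
  let θ (m : ℕ) := f m.unpair.1
  refine ⟨fun m => if h : (θ m).1 ≤ m + 1 then (θ m).2.1.relabel (Fin.castLE h) else
    (Term.var 0).equal (Term.var 0), fun m => ?_, fun {n} φ hφ => ?_⟩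
  · split_ifs
    · exact (θ m).2.2.relabel _
    · exact .equal _ _
  · obtain ⟨i, hi⟩ := hf ⟨n, φ, hφ⟩
    obtain ⟨k, hk⟩ := Nat.exists_eq_add_of_le (Nat.right_le_pair i n)
    have hθ : θ (n + k) = ⟨n, φ, hφ⟩ := by rw [← hk, ← hi]; simp only [θ, Nat.unpair_pair]
    refine ⟨k, ?_⟩
    generalize θ (n + k) = e at hθ
    subst hθ
    exact dif_pos (Nat.le_add_right n (k + 1))

open Classical in
/-- The colour of a tuple lists, in binary digits after a leading `1`, the truth values of the
first formulas of the enumeration, the `m`-th one for the initial segment of length `m + 1`. -/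
noncomputable def colouring (enum : ∀ m, L.Formula (Fin (m + 1))) (S : L.Structure X) :
    Node X → ℕ
  | ⟨0, _⟩ => 1
  | ⟨n + 1, t⟩ => Nat.bit (decide ((enum n).Realize t)) (colouring enum S ⟨n, Fin.init t⟩)
termination_by t => t.1

variable {enum : ∀ m, L.Formula (Fin (m + 1))} {S : L.Structure X} {S' : L.Structure X'}

theorem colouring_pos (t : Node X) : 0 < colouring enum S t := by
  obtain ⟨n, t⟩ := t
  induction n with
  | zero => rw [colouring]; exact Nat.one_pos
  | succ n ih =>
    have := ih (Fin.init t)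
    rw [colouring, Nat.bit_val]
    lia

theorem isGrowing_colouring (enum : ∀ m, L.Formula (Fin (m + 1))) (S : L.Structure X) :
    IsGrowing (colouring enum S) where
  pos := colouring_pos
  lt_snoc {n} t x := by
    have := colouring_pos (enum := enum) (S := S) ⟨n, t⟩
    rw [colouring, Fin.init_snoc, Nat.bit_val]
    lia

theorem bit_eq_bit_iff {a b : Bool} {m n : ℕ} : Nat.bit a m = Nat.bit b n ↔ a = b ∧ m = n := by
  refine ⟨fun h => ⟨?_, ?_⟩, fun ⟨ha, hm⟩ => congrArg₂ _ ha hm⟩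
  · rw [← Nat.testBit_bit_zero a m, h, Nat.testBit_bit_zero]
  · rw [← Nat.bit_div_two a m, h, Nat.bit_div_two]

theorem sameColour_succ_iff {n : ℕ} {s : Fin (n + 1) → X} {t : Fin (n + 1) → X'} :
    SameColour (colouring enum S) (colouring enum S') s t ↔
      ((enum n).Realize s ↔ (enum n).Realize t) ∧
        SameColour (colouring enum S) (colouring enum S') (Fin.init s) (Fin.init t) := by
  rw [SameColour, colouring, colouring, bit_eq_bit_iff, decide_eq_decide, SameColour]

theorem AtomicEquiv.sameColour (henum : IsAtomicEnumeration enum) {n : ℕ} {s : Fin n → X}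
    {t : Fin n → X'} (h : AtomicEquiv S S' s t) :
    SameColour (colouring enum S) (colouring enum S') s t := by
  induction n with
  | zero => rw [SameColour, colouring, colouring]
  | succ n ih =>
    exact sameColour_succ_iff.2 ⟨h _ (henum.isAtomic n), ih (h.comp Fin.castSucc)⟩

theorem IsBackForth.atomicEquiv [Nonempty X] (henum : IsAtomicEnumeration enum)
    {B : TupleRel X X'} (hB : IsBackForth (SameColour (colouring enum S) (colouring enum S')) B)
    {n : ℕ} {s : Fin n → X} {t : Fin n → X'} (h : B s t) : AtomicEquiv S S' s t := by
  intro θ hθ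
  obtain ⟨k, hk⟩ := henum.exists_eq θ hθ
  obtain ⟨w, hw⟩ := hB.exists_append h fun _ : Fin (k + 1) => Classical.arbitrary X
  have hrealize := (sameColour_succ_iff (n := n + k)).1 (hB.sub hw) |>.1
  simpa only [hk, Formula.realize_relabel, Function.comp_def, Fin.append_left] using hrealize

theorem backForth_colouring_iff [Nonempty X] (henum : IsAtomicEnumeration enum) :
    BackForth (SameColour (colouring enum S) (colouring enum S')) ↔
      BackForth (AtomicEquiv S S') :=
  exists_congr fun _ => and_congr_left' ⟨fun hB => ⟨hB.atomicEquiv henum, hB.forth, hB.back⟩,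
    fun hB => ⟨fun h => (hB.sub h).sameColour henum, hB.forth, hB.back⟩⟩

end Colouring

/-! ### Measurability -/

section Measurability

variable {L : FirstOrder.Language.{v, w}} {X : Type*} {Ω : Type*} [MeasurableSpace Ω]

/-- The truth of quantifier-free formulas at fixed tuples depends measurably on the structure of
the family. -/
def MeasurableFamily (S : Ω → L.Structure X) : Prop :=
  ∀ ⦃n : ℕ⦄ (θ : L.Formula (Fin n)), θ.IsQF → ∀ a : Fin n → X,
    MeasurableSet {ω | @Formula.Realize L X (S ω) _ θ a}

theorem measurableFamily_of_isRelational [L.IsRelational] {S : Ω → L.Structure X}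
    (hS : ∀ ⦃l : ℕ⦄ (R : L.Relations l) (a : Fin l → X), MeasurableSet {ω | (S ω).RelMap R a}) :
    MeasurableFamily S := by
  suffices h : ∀ {n k : ℕ} {φ : L.BoundedFormula (Fin n) k}, φ.IsQF → ∀ (a : Fin n → X)
      (b : Fin k → X), MeasurableSet {ω | @BoundedFormula.Realize L X (S ω) _ _ φ a b} from
    fun n θ hθ a => h hθ a default
  intro n k φ hφ a b
  induction hφ with
  | falsum => exact .empty
  | imp _ _ h₁ h₂ => exact h₁.imp h₂
  | of_isAtomic h =>
    cases h with
    | equal s t =>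
      obtain ⟨i, rfl⟩ := exists_eq_var s
      obtain ⟨j, rfl⟩ := exists_eq_var t
      exact .const (Sum.elim a b i = Sum.elim a b j)
    | rel R ts =>
      choose i hi using fun j => exists_eq_var (ts j)
      obtain rfl : ts = fun j => .var (i j) := funext hi
      exact hS R fun j => Sum.elim a b (i j)

theorem MeasurableFamily.measurable_colouring {S : Ω → L.Structure X} (hS : MeasurableFamily S)
    {enum : ∀ m, L.Formula (Fin (m + 1))} (henum : IsAtomicEnumeration enum) (t : Node X) :
    Measurable fun ω => colouring enum (S ω) t := by
  obtain ⟨n, t⟩ := t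
  induction n with
  | zero =>
    simp only [colouring]
    exact measurable_const
  | succ n ih =>
    classical
    simp only [colouring, Nat.bit_val, Bool.toNat, Bool.cond_decide]
    exact ((ih _).const_mul 2).add <|
      .ite (hS (enum n) (henum.isAtomic n).isQF t) measurable_const measurable_const

theorem measurableSet_lt_weight {c : Ω → Node X → ℕ} (hc : ∀ t, Measurable fun ω => c ω t)
    (i : ℕ) : ∀ s : State X, MeasurableSet {ω | (i : ℕ∞) < s.weight (c ω)}
  | none => .const ((i : ℕ∞) < ⊤)
  | some t => by
    simp only [State.weight, Nat.cast_lt]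
    exact measurableSet_lt measurable_const (hc t)

theorem exists_simpleFunc_eq_codePath {c : Ω → Node X → ℕ}
    (hc : ∀ t, Measurable fun ω => c ω t) (x : Path X × ℕ) :
    ∃ f : MeasureTheory.SimpleFunc Ω (Path X), ∀ ω, f ω = codePath (c ω) x := by
  refine ⟨.piecewise _ (measurableSet_lt_weight hc x.2 x.1.final) (.const Ω x.1)
    (.const Ω (deadPath X)), fun ω => ?_⟩
  rw [MeasureTheory.SimpleFunc.piecewise_apply, codePath]
  exact ite_congr rfl (fun _ => rfl) fun _ => rfl

theorem measurableFamily_pathStructure_codePath {c : Ω → Node X → ℕ}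
    (hc : ∀ t, Measurable fun ω => c ω t) {W : Type*} (e : W → Path X × ℕ) :
    MeasurableFamily fun ω => pathStructure (codePath (c ω) ∘ e) := by
  refine measurableFamily_of_isRelational fun l R a => ?_
  obtain ⟨n⟩ := R
  obtain ⟨f, hf⟩ := exists_simpleFunc_eq_codePath hc (e (a 0))
  obtain ⟨g, hg⟩ := exists_simpleFunc_eq_codePath hc (e (a 1))
  convert (f.pair g).measurableSet_preimage {p | res p.1 n = res p.2 n} using 1
  ext ω
  simp only [Set.mem_preimage, Set.mem_ofPred_eq, MeasureTheory.SimpleFunc.pair_apply, hf, hg]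
  rfl

end Measurability

/-! ### The reduction -/

section Reduction

variable {L : FirstOrder.Language.{v, w}} {X : Type*} [Infinite X] {X' : Type*} [Infinite X']
  {enum : ∀ m, L.Formula (Fin (m + 1))}

/-- The model of `REF(inf)` that codes a structure with the same universe. -/
@[reducible]
noncomputable def codeStructure (enum : ∀ m, L.Formula (Fin (m + 1))) (S : L.Structure X) :
    refLanguage.Structure X :=
  pathStructure (codePath (colouring enum S) ∘ pathEquiv X)

theorem codes_codePath_comp_pathEquiv (c : Node X → ℕ) : Codes c (codePath c ∘ pathEquiv X) :=
  (codes_codePath c).comp_equiv _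

theorem backForth_codeStructure_iff (henum : IsAtomicEnumeration enum) (S : L.Structure X)
    (S' : L.Structure X') :
    BackForth (AtomicEquiv (codeStructure enum S) (codeStructure enum S')) ↔
      BackForth (AtomicEquiv S S') :=
  (backForth_pathStructure_iff (codes_codePath_comp_pathEquiv _) (codes_codePath_comp_pathEquiv _)
    (isGrowing_colouring enum S) (isGrowing_colouring enum S')).trans
    (backForth_colouring_iff henum)

end Reduction

namespace Mod

variable {L : FirstOrder.Language.{0, 0}} {Φ Ψ : InfSentence L (ℵ₁ : Cardinal.{0})} {X : Type u}

/-- `codeStructure` as a map between spaces of models. -/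
noncomputable def code [Infinite X] (enum : ∀ m, L.Formula (Fin (m + 1))) (M : Mod Ψ X) :
    Mod refInf X :=
  ⟨codeStructure enum M.1,
    (codes_codePath_comp_pathEquiv _).holds_refInf (isGrowing_colouring enum M.1)⟩

theorem measurableSet_preimage_code [Infinite X] [m : MeasurableSpace (Mod Ψ X)]
    (hΨ : ∀ U ∈ subbasis Ψ X, MeasurableSet U) {enum : ∀ m, L.Formula (Fin (m + 1))}
    (henum : IsAtomicEnumeration enum) {U : Set (Mod refInf X)} (hU : U ∈ subbasis refInf X) :
    MeasurableSet (code (Ψ := Ψ) enum ⁻¹' U) := by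
  obtain ⟨n, θ, a, hθ, rfl⟩ := hU
  have hfamily : MeasurableFamily fun M : Mod Ψ X => M.1 :=
    fun n θ hθ a => hΨ _ ⟨n, θ, a, hθ, rfl⟩
  exact measurableFamily_pathStructure_codePath (hfamily.measurable_colouring henum)
    (pathEquiv X) θ hθ a

theorem iso_code_iff [Infinite X] [Countable X] {enum : ∀ m, L.Formula (Fin (m + 1))}
    (henum : IsAtomicEnumeration enum) (M N : Mod Ψ X) :
    (code enum M).Iso (code enum N) ↔ M.Iso N :=
  nonempty_equiv_iff_backForth.trans <|
    (backForth_codeStructure_iff henum M.1 N.1).trans nonempty_equiv_iff_backForth.symm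

theorem equivalent_code_iff [Infinite X] {enum : ∀ m, L.Formula (Fin (m + 1))}
    (henum : IsAtomicEnumeration enum) (M N : Mod Ψ X) :
    (code enum M).Equivalent (code enum N) ↔ M.Equivalent N :=
  infEquiv_iff_backForth.trans <|
    (backForth_codeStructure_iff henum M.1 N.1).trans infEquiv_iff_backForth.symm

theorem countable_subbasis [Countable L.Symbols] [Countable X] : (subbasis Φ X).Countable := by
  refine (Set.countable_range fun p : Σ n, L.Formula (Fin n) × (Fin n → X) =>
    basicSet Φ p.2.1 p.2.2).mono ?_
  rintro _ ⟨n, θ, a, -, rfl⟩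
  exact ⟨⟨n, θ, a⟩, rfl⟩

theorem borel_eq_generateFrom_subbasis [Countable L.Symbols] [Countable X] :
    borel (Mod Φ X) = MeasurableSpace.generateFrom (subbasis Φ X) :=
  have : SecondCountableTopology (Mod Φ X) := ⟨⟨_, countable_subbasis, rfl⟩⟩
  borel_eq_generateFrom_of_subbasis rfl

end Mod

instance : Countable refLanguage.Symbols := by
  refine Function.Surjective.countable (f := fun n : ℕ => Sum.inr ⟨2, symE n⟩) ?_
  rintro (⟨_, f⟩ | ⟨_, ⟨n⟩⟩)
  · exact f.elim
  · exact ⟨n, rfl⟩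

open scoped MeasureTheory in
theorem borelComplete_refInf : BorelComplete refInf := by
  intro L' _ Ψ
  obtain ⟨enum, henum⟩ := exists_isAtomicEnumeration L'
  refine ⟨Mod.code enum, ?_, fun M N => (Mod.iso_code_iff henum M N).symm⟩
  have measurableSet_of_mem_subbasis : ∀ U ∈ Mod.subbasis Ψ ℕ, MeasurableSet[borel _] U :=
    fun U hU => MeasurableSpace.measurableSet_generateFrom (show IsOpen U from .basic U hU)
  rw [Mod.borel_eq_generateFrom_subbasis (Φ := refInf)]
  exact @measurable_generateFrom _ _ (borel _) _ _ fun U =>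
    Mod.measurableSet_preimage_code (m := borel _) measurableSet_of_mem_subbasis henum

/-- The `σ`-algebra of the `λ`-Borel sets. -/
@[reducible]
def lambdaBorelSpace {lam : Cardinal.{u}} (hlam : ℵ₀ ≤ lam) {Y : Type u} (B : Set (Set Y)) :
    MeasurableSpace Y where
  MeasurableSet' := LambdaBorel lam B
  measurableSet_empty := by
    rw [← Set.iUnion_of_empty (ι := PEmpty.{u + 1}) PEmpty.elim]
    exact .iUnion PEmpty (by simp only [mk_eq_zero, zero_le]) _ fun i => i.elim
  measurableSet_compl := .compl
  measurableSet_iUnion f hf := by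
    rw [← Equiv.ulift.{u}.surjective.iUnion_comp f]
    exact .iUnion _ (by rwa [mk_uLift, mk_nat, lift_aleph0]) _ fun i => hf i.down

theorem lambdaBorelComplete_refInf {lam : Cardinal.{u}} (hlam : ℵ₀ ≤ lam) :
    LambdaBorelComplete lam refInf := by
  intro L' _ Ψ
  obtain ⟨enum, henum⟩ := exists_isAtomicEnumeration L'
  have : Infinite lam.ord.ToType := by rwa [infinite_iff, mk_ord_toType]
  exact ⟨Mod.code enum,
    fun U => Mod.measurableSet_preimage_code (m := lambdaBorelSpace hlam (Mod.subbasis Ψ _))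
      LambdaBorel.basic henum,
    fun M N => (Mod.equivalent_code_iff henum M N).symm⟩

end BorelComplexity

theorem mainTheorem8 :
    BorelComplexity.BorelComplete BorelComplexity.refInf ∧
      ∀ lam : Cardinal.{u}, Cardinal.aleph0 ≤ lam →
        BorelComplexity.LambdaBorelComplete lam BorelComplexity.refInf :=
  ⟨BorelComplexity.borelComplete_refInf, fun _ => BorelComplexity.lambdaBorelComplete_refInf⟩
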